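/- Let $\Sigma$ be a nonempty finite alphabet of size $\Delta$ and let $P$ be a string of length $n$ over $\Sigma$. For characters $u,v\in\Sigma$ (not necessarily distinct) let $sparse^{(u,v)}(P)$ be the rightmost occurrence of a longest substring of $P$ that starts with $u$, ends with $v$, and contains neither $u$ nor $v$ strictly between its first and its last position (the empty string if there is no such substring; a single character $u$ counts as a substring that starts and ends with $u$). Let $sparse(P)$ be the rightmost occurring among the longest of the strings $sparse^{(u,v)}(P)$, $u,v\in\Sigma$, and let $|sparse(P)|$ be its length. Theorem. Let $P$ be drawn uniformly at random from the $\Delta^n$ strings of length $n$ over $\Sigma$. Then $$E[|sparse(P)|] = \Omega\Big(\Delta \log\frac{2\Delta}{2\Delta-\delta+1}\Big).$$ Precisely, there is an absolute constant $c>0$ such that for every alphabet size $\Delta\ge 1$ and every length $n$: (i) for every integer $0\le\delta\le\min(n,\Delta)$, $$E[|sparse(P)|]\ \ge\ c\,\Delta\log\frac{2\Delta}{2\Delta-\delta+1};$$ (ii) if $\delta(P)$ denotes the (random) number of distinct characters of $P$, then $$E[|sparse(P)|]\ \ge\ c\;E\Big[\Delta\log\frac{2\Delta}{2\Delta-\delta(P)+1}\Big].$$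 -/

import Mathlib

namespace TwoSparse

variable {A : Type*} [DecidableEq A] {n : ℕ}

/-- The substring of `P` occupying the positions `i, i + 1, …, j` starts with `u`, ends with `v`,
and contains neither `u` nor `v` strictly between its first and its last position. -/
def IsTwoSparse (P : Fin n → A) (u v : A) (i j : Fin n) : Prop :=
  i ≤ j ∧ P i = u ∧ P j = v ∧ ∀ k : Fin n, i < k → k < j → P k ≠ u ∧ P k ≠ v

instance (P : Fin n → A) (u v : A) (i j : Fin n) : Decidable (IsTwoSparse P u v i j) := by
  unfold IsTwoSparse; infer_instance

/-- The occurrences of substrings that start with `u`, end with `v` and do not contain `u`, `v`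
inside. An occurrence is recorded as the pair (length, starting position), and such pairs are
ordered lexicographically, so that a larger pair is a longer substring, or one of the same length
that occurs further to the right. -/
def occurrences (P : Fin n → A) (u v : A) : Finset (ℕ ×ₗ ℕ) :=
  (Finset.univ.filter fun p : Fin n × Fin n => IsTwoSparse P u v p.1 p.2).image
    fun p => toLex ((p.2 : ℕ) - (p.1 : ℕ) + 1, (p.1 : ℕ))

/-- The rightmost occurrence of a longest substring that starts with `u`, ends with `v` and does
not contain `u` or `v` inside; `⊥` if there is no such substring. -/
def pairOccurrence (P : Fin n → A) (u v : A) : WithBot (ℕ ×ₗ ℕ) :=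
  (occurrences P u v).max

/-- The rightmost one among the longest of the occurrences `pairOccurrence P u v`, where `u` and
`v` range over the alphabet. -/
def sparseOccurrence [Fintype A] (P : Fin n → A) : WithBot (ℕ ×ₗ ℕ) :=
  Finset.univ.sup fun w : A × A => pairOccurrence P w.1 w.2

/-- The string found at an occurrence (the empty string for `⊥`). -/
def substringAt (P : Fin n → A) (o : WithBot (ℕ ×ₗ ℕ)) : List A :=
  WithBot.recBotCoe [] (fun q => ((List.ofFn P).drop (ofLex q).2).take (ofLex q).1) o

/-- The 2-sparse pattern of `P` with respect to `u` and `v`. -/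
def sparsePair (P : Fin n → A) (u v : A) : List A :=
  substringAt P (pairOccurrence P u v)

/-- The string `sparse(P)`: the rightmost among the longest 2-sparse patterns of `P`. -/
def sparse [Fintype A] (P : Fin n → A) : List A :=
  substringAt P (sparseOccurrence P)

/-- The number of distinct characters of `P`. -/
def numDistinct (P : Fin n → A) : ℕ :=
  (Finset.univ.image P).card

/-- The expectation of `X P` for a string `P` drawn uniformly at random from all strings of
length `n` over the alphabet `A`. -/
noncomputable def expectation [Fintype A] (X : (Fin n → A) → ℝ) : ℝ :=
  (∑ P : Fin n → A, X P) / (Fintype.card (Fin n → A) : ℝ)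

/-- The quantity `Δ log (2Δ / (2Δ - δ + 1))`, computed in the reals. -/
noncomputable def logBound (Δ δ : ℕ) : ℝ :=
  (Δ : ℝ) * Real.log (2 * (Δ : ℝ) / (2 * (Δ : ℝ) - (δ : ℝ) + 1))

end TwoSparse

namespace TwoSparse

variable {A : Type*} [DecidableEq A] {n : ℕ}

/-! The logarithm plays no real role: `log x ≤ x - 1` gives `logBound Δ δ ≤ δ` (`logBound_le`). Both
δ and δ(P) are at most `min n Δ`, so each part follows once the expected length is at least `m / 8`
for all `m ≤ min n Δ` (`le_expectation_length_sparse`). For this a single window, the prefix on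
positions `0, …, m / 4`, suffices: by a union bound it is 2-sparse for its own end characters with
probability at least 1/2. -/

theorem exists_isTwoSparse_of_mem_occurrences {P : Fin n → A} {u v : A} {q : ℕ ×ₗ ℕ}
    (hq : q ∈ occurrences P u v) :
    ∃ i j : Fin n, IsTwoSparse P u v i j ∧ q = toLex ((j : ℕ) - (i : ℕ) + 1, (i : ℕ)) := by
  simp only [occurrences, Finset.mem_image, Finset.mem_filter, Finset.mem_univ, true_and] at hq
  obtain ⟨⟨i, j⟩, h, rfl⟩ := hq
  exact ⟨i, j, h, rfl⟩

/-- The supremum of the maxima of finitely many finite sets is attained, and bounds them. -/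
theorem exists_sup_max_eq_coe {α ι : Type*} [LinearOrder α] [Fintype ι] (s : ι → Finset α)
    {i : ι} {a : α} (ha : a ∈ s i) :
    ∃ q : α, (Finset.univ.sup fun k => (s k).max) = (q : WithBot α) ∧ a ≤ q ∧ ∃ k, q ∈ s k := by
  have hle : (a : WithBot α) ≤ Finset.univ.sup fun k => (s k).max :=
    (Finset.le_max ha).trans (Finset.le_sup (f := fun k => (s k).max) (Finset.mem_univ i))
  obtain ⟨k, -, hk⟩ := Finset.exists_mem_eq_sup Finset.univ ⟨i, Finset.mem_univ i⟩
    fun k => (s k).max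
  obtain ⟨q, hq, haq⟩ := WithBot.coe_le_iff.1 hle
  exact ⟨q, hq, haq, k, Finset.mem_of_max (hk.symm.trans hq)⟩

theorem mem_occurrences {P : Fin n → A} {u v : A} {i j : Fin n} (h : IsTwoSparse P u v i j) :
    toLex ((j : ℕ) - (i : ℕ) + 1, (i : ℕ)) ∈ occurrences P u v :=
  Finset.mem_image.2 ⟨(i, j), Finset.mem_filter.2 ⟨Finset.mem_univ _, h⟩, rfl⟩

/-- Every 2-sparse substring is at most as long as `sparse P`. -/
theorem length_le_length_sparse [Fintype A] {P : Fin n → A} {u v : A} {i j : Fin n}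
    (h : IsTwoSparse P u v i j) : (j : ℕ) - (i : ℕ) + 1 ≤ (sparse P).length := by
  obtain ⟨q, hq, hle, w, hw⟩ := exists_sup_max_eq_coe
    (fun w : A × A => occurrences P w.1 w.2) (i := (u, v)) (mem_occurrences h)
  change sparseOccurrence P = q at hq
  obtain ⟨i', j', h', rfl⟩ := exists_isTwoSparse_of_mem_occurrences hw
  have hlen : (j : ℕ) - (i : ℕ) + 1 ≤ (j' : ℕ) - (i' : ℕ) + 1 := by
    rcases (Prod.Lex.toLex_le_toLex).1 hle with h | h
    · exact h.le
    · exact h.1.le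
  have hij : (i' : ℕ) ≤ j' := h'.1
  have hj := j'.isLt
  rw [sparse, hq]
  change _ ≤ (((List.ofFn P).drop (i' : ℕ)).take ((j' : ℕ) - (i' : ℕ) + 1)).length
  -- The occurrence ends at `j' < n`, so `take` is not cut short.
  rw [List.length_take, List.length_drop, List.length_ofFn]
  omega

/-- Two distinct positions carry the same character in at most a `1 / Δ` fraction of strings. -/
theorem card_filter_eq_mul_card_le [Fintype A] {a b : Fin n} (hab : a ≠ b) :
    (Finset.univ.filter fun P : Fin n → A => P a = P b).card * Fintype.card A ≤
      Fintype.card (Fin n → A) := by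
  rw [← Finset.card_univ (α := A), ← Finset.card_product, ← Finset.card_univ (α := Fin n → A)]
  -- Overwriting position `a` loses nothing: the old character survives at `b`, and the new one is
  -- read off at `a`.
  refine Finset.card_le_card_of_injOn (fun x => Function.update x.1 a x.2)
    (fun _ _ => Finset.mem_coe.2 (Finset.mem_univ _)) ?_
  rintro ⟨P, x⟩ hP ⟨Q, y⟩ hQ h
  simp only [Finset.coe_product, Set.mem_prod, Finset.mem_coe, Finset.mem_filter,
    Finset.mem_univ, true_and, and_true] at hP hQ
  have hne : ∀ k, k ≠ a → P k = Q k := fun k hk => by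
    simpa [Function.update_of_ne hk] using congrFun h k
  have hxy : x = y := by simpa using congrFun h a
  have hPQ : P = Q := by
    funext k
    by_cases hk : k = a
    · rw [hk, hP, hQ, hne b hab.symm]
    · exact hne k hk
  rw [hPQ, hxy]

/-- Union bound: at most `j ≤ Δ / 4` interior positions, each agreeing with one of the two ends with
probability at most `2 / Δ`, so failure has probability at most 1/2. -/
theorem card_le_two_mul_card_isTwoSparse [Fintype A] [Nonempty A] {i j : Fin n} (hij : i ≤ j)
    (hj : 4 * (j : ℕ) ≤ Fintype.card A) :
    Fintype.card (Fin n → A) ≤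
      2 * (Finset.univ.filter fun P : Fin n → A => IsTwoSparse P (P i) (P j) i j).card := by
  set good := Finset.univ.filter fun P : Fin n → A => IsTwoSparse P (P i) (P j) i j
  set bad := Finset.univ.filter fun P : Fin n → A => ¬ IsTwoSparse P (P i) (P j) i j
  have hsum : good.card + bad.card = Fintype.card (Fin n → A) := by
    rw [← Finset.card_univ]
    exact Finset.card_filter_add_card_filter_not _
  have hsub : bad ⊆ (Finset.Ioo i j).biUnion fun k =>
      (Finset.univ.filter fun P : Fin n → A => P k = P i) ∪
        Finset.univ.filter fun P : Fin n → A => P k = P j := by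
    intro P hP
    have hP' : ¬ ∀ k : Fin n, i < k → k < j → P k ≠ P i ∧ P k ≠ P j :=
      fun h => (Finset.mem_filter.1 hP).2 ⟨hij, rfl, rfl, h⟩
    push Not at hP'
    obtain ⟨k, hik, hkj, hk⟩ := hP'
    simp only [Finset.mem_biUnion, Finset.mem_Ioo, Finset.mem_union, Finset.mem_filter,
      Finset.mem_univ, true_and]
    exact ⟨k, ⟨hik, hkj⟩, or_iff_not_imp_left.2 hk⟩
  have hbad : bad.card * Fintype.card A ≤ (Finset.Ioo i j).card *
      (2 * Fintype.card (Fin n → A)) := by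
    refine (Nat.mul_le_mul_right _ ((Finset.card_le_card hsub).trans
      Finset.card_biUnion_le)).trans ?_
    rw [Finset.sum_mul]
    refine (Finset.sum_le_card_nsmul _ _ _ fun k hk => ?_).trans_eq (smul_eq_mul _ _)
    have hk := Finset.mem_Ioo.1 hk
    refine (Nat.mul_le_mul_right _ (Finset.card_union_le _ _)).trans ?_
    rw [add_mul, two_mul]
    exact add_le_add (card_filter_eq_mul_card_le hk.1.ne') (card_filter_eq_mul_card_le hk.2.ne)
  have hIoo : (Finset.Ioo i j).card ≤ j := by
    rw [Fin.card_Ioo]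
    omega
  have hmul : (2 * bad.card) * Fintype.card A ≤
      Fintype.card (Fin n → A) * Fintype.card A := by
    have h₁ := Nat.mul_le_mul_right (2 * Fintype.card (Fin n → A)) hIoo
    have h₂ := Nat.mul_le_mul_left (Fintype.card (Fin n → A)) hj
    nlinarith
  have := Nat.le_of_mul_le_mul_right hmul Fintype.card_pos
  omega

theorem expectation_mono {A : Type*} {n : ℕ} [Fintype A] {X Y : (Fin n → A) → ℝ} (h : ∀ P, X P ≤ Y P) :
    expectation X ≤ expectation Y :=
  div_le_div_of_nonneg_right (Finset.sum_le_sum fun P _ => h P) (Nat.cast_nonneg _)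

theorem expectation_const {A : Type*} {n : ℕ} [Fintype A] [Nonempty A] (r : ℝ) :
    expectation (fun _ : Fin n → A => r) = r := by
  have : (Fintype.card (Fin n → A) : ℝ) ≠ 0 := Nat.cast_ne_zero.2 Fintype.card_ne_zero
  rw [expectation, Finset.sum_const, Finset.card_univ, nsmul_eq_mul, mul_div_cancel_left₀ _ this]

/-- The expected length of `sparse P` is at least an eighth of `min n Δ`. -/
theorem le_expectation_length_sparse [Fintype A] [Nonempty A] {m : ℕ} (hn : m ≤ n)
    (hA : m ≤ Fintype.card A) :
    (1 / 8 : ℝ) * m ≤ expectation fun P : Fin n → A => ((sparse P).length : ℝ) := by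
  rcases Nat.eq_zero_or_pos m with rfl | hm
  · have := expectation_mono (X := fun _ : Fin n → A => (0 : ℝ))
      (Y := fun P => ((sparse P).length : ℝ)) fun P => Nat.cast_nonneg _
    rw [expectation_const] at this
    simpa using this
  · let i : Fin n := ⟨0, by omega⟩
    -- Rounding down keeps `4 * j ≤ Δ`, while the window length `m / 4 + 1` is still at least a
    -- quarter of `m`. Positivity of `m` puts both ends inside `Fin n`.
    let j : Fin n := ⟨m / 4, by omega⟩
    have hcard : Fintype.card (Fin n → A) ≤
        2 * (Finset.univ.filter fun P : Fin n → A => IsTwoSparse P (P i) (P j) i j).card :=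
      card_le_two_mul_card_isTwoSparse (Nat.zero_le _) (show 4 * (m / 4) ≤ _ by omega)
    have hcount : (Finset.univ.filter fun P : Fin n → A =>
        IsTwoSparse P (P i) (P j) i j).card * (m / 4 + 1) ≤
          ∑ P : Fin n → A, (sparse P).length := by
      rw [← smul_eq_mul]
      exact (Finset.card_nsmul_le_sum _ _ _ fun P hP =>
        length_le_length_sparse (Finset.mem_filter.1 hP).2).trans
          (Finset.sum_le_sum_of_subset (Finset.filter_subset _ _))
    have hm4 : m ≤ 4 * (m / 4 + 1) := by omega
    have hnat : m * Fintype.card (Fin n → A) ≤ 8 * ∑ P : Fin n → A, (sparse P).length :=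
      calc _ ≤ 4 * (m / 4 + 1) * (2 * _) := Nat.mul_le_mul hm4 hcard
        _ = 8 * (_ * (m / 4 + 1)) := by ring
        _ ≤ _ := Nat.mul_le_mul_left 8 hcount
    have hreal : (m : ℝ) * Fintype.card (Fin n → A) ≤
        8 * ∑ P : Fin n → A, ((sparse P).length : ℝ) := by exact_mod_cast hnat
    rw [expectation, le_div_iff₀ (Nat.cast_pos.2 Fintype.card_pos)]
    linarith

theorem logBound_le {Δ δ : ℕ} (hΔ : 0 < Δ) (h : δ ≤ Δ) : logBound Δ δ ≤ δ := by
  have h₁ : (0 : ℝ) < Δ := Nat.cast_pos.2 hΔ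
  have h₂ : (δ : ℝ) ≤ Δ := Nat.cast_le.2 h
  have h₃ : (0 : ℝ) ≤ δ := Nat.cast_nonneg _
  have h₄ : 0 < 2 * (Δ : ℝ) - δ + 1 := by linarith
  calc logBound Δ δ ≤ Δ * (2 * (Δ : ℝ) / (2 * Δ - δ + 1) - 1) :=
        mul_le_mul_of_nonneg_left (Real.log_le_sub_one_of_pos (by positivity)) h₁.le
    _ = Δ * (δ - 1) / (2 * Δ - δ + 1) := by
      rw [div_sub_one h₄.ne', mul_div_assoc]
      ring
    _ ≤ δ := by
      rw [div_le_iff₀ h₄]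
      -- The difference of the two sides is `δ (Δ - δ) + δ + Δ`.
      nlinarith [mul_nonneg h₃ (sub_nonneg.2 h₂)]

theorem numDistinct_le_length (P : Fin n → A) : numDistinct P ≤ n := by
  simpa [numDistinct] using Finset.card_image_le (s := Finset.univ) (f := P)

theorem numDistinct_le_card [Fintype A] (P : Fin n → A) : numDistinct P ≤ Fintype.card A :=
  Finset.card_le_univ _

end TwoSparse

theorem theorem7 :
    ∃ c : ℝ, 0 < c ∧
      ∀ (A : Type*) [Fintype A] [DecidableEq A] [Nonempty A] (n : ℕ),
        (∀ δ : ℕ, δ ≤ n → δ ≤ Fintype.card A →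
          c * TwoSparse.logBound (Fintype.card A) δ ≤
            TwoSparse.expectation (fun P : Fin n → A => ((TwoSparse.sparse P).length : ℝ))) ∧
        c * TwoSparse.expectation
              (fun P : Fin n → A =>
                TwoSparse.logBound (Fintype.card A) (TwoSparse.numDistinct P)) ≤
          TwoSparse.expectation (fun P : Fin n → A => ((TwoSparse.sparse P).length : ℝ)) := by
  refine ⟨1 / 8, by norm_num, fun A _ _ _ n => ⟨fun δ hn hA => ?_, ?_⟩⟩
  · exact (mul_le_mul_of_nonneg_left (TwoSparse.logBound_le Fintype.card_pos hA)
      (by norm_num)).trans (TwoSparse.le_expectation_length_sparse hn hA)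
  · have hle : TwoSparse.expectation (fun P : Fin n → A =>
        TwoSparse.logBound (Fintype.card A) (TwoSparse.numDistinct P)) ≤
          ((min n (Fintype.card A) : ℕ) : ℝ) := by
      rw [← TwoSparse.expectation_const (A := A) (n := n) ((min n (Fintype.card A) : ℕ) : ℝ)]
      refine TwoSparse.expectation_mono fun P => ?_
      exact (TwoSparse.logBound_le Fintype.card_pos (TwoSparse.numDistinct_le_card P)).trans
        (Nat.cast_le.2 (le_min (TwoSparse.numDistinct_le_length P)
          (TwoSparse.numDistinct_le_card P)))
    exact (mul_le_mul_of_nonneg_left hle (by norm_num)).trans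
      (TwoSparse.le_expectation_length_sparse (min_le_left _ _) (min_le_right _ _))
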